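/- Let $m>-1/2$, $b>0$, $c>1$. The McKay Type I distribution with parameters $m,b,c$ is the probability distribution on $\mathbb{R}$ with density $$p(x)=\frac{\sqrt{\pi}\,(c^2-1)^{m+1/2}}{2^m b^{m+1}\Gamma(m+\frac12)}\,x^m\mathrm{e}^{-cx/b}\,I_m\Big(\frac{x}{b}\Big),\quad x>0,\qquad p(x)=0,\quad x\le 0,$$ where $I_\nu(x)=\sum_{k=0}^\infty \frac{(x/2)^{\nu+2k}}{\Gamma(\nu+k+1)\,k!}$ is the modified Bessel function of the first kind. A distribution on $\mathbb{R}$ is unimodal with mode $M$ if its distribution function is convex on $(-\infty,M)$ and concave on $(M,\infty)$. The McKay Type I distribution is unimodal, with a unique mode $M$. If $-1/2<m\le 0$, then $M=0$. If $m>0$, then $M>0$, $M$ is the unique maximum point of $p$ on $(0,\infty)$, and $$\frac{(2m-1)bc}{c^2-1}<M<\frac{bc}{c^2-1}\Big[m-\tfrac12+\sqrt{(m+\tfrac12)^2-2m/c^2}\Big]<\frac{2mbc}{c^2-1}.$$ Moreover, for $m>0$, a random variable $X$ with this distribution has a finite mean and $$\frac{bc}{c^2-1}<\frac{bc}{c^2-1}\Big[\tfrac32+m-\sqrt{(m+\tfrac12)^2-2m/c^2}\Big]<\mathbb{E}[X]-M<\frac{2bc}{c^2-1}.$$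 Also, for $m>0$, $$M>\frac{bc}{c^2-1}\Big[m-1+\sqrt{(m-1)^2+4(c^2-1)m/c^2}\Big].$$ The outer lower and upper bounds for $M$ are best possible amongst all bounds of the form $(2m-\alpha)bc/(c^2-1)$ with $\alpha\in\mathbb{R}$ not depending on the parameters: $\alpha=1$ is the least $\alpha$ such that $(2m-\alpha)bc/(c^2-1)\le M$ for all $m>0$, $b>0$, $c>1$, and $\alpha=0$ is the greatest $\alpha$ such that $M\le(2m-\alpha)bc/(c^2-1)$ for all $m>0$, $b>0$, $c>1$. Likewise, the outer lower and upper bounds for $\mathbb{E}[X]-M$ are best possible amongst all bounds of the form $\beta bc/(c^2-1)$ with $\beta\in\mathbb{R}$ not depending on the parameters: $\beta=1$ is the greatest $\beta$ such that $\beta bc/(c^2-1)\le\mathbb{E}[X]-M$ for all $m>0$, $b>0$, $c>1$, and $\beta=2$ is the least $\beta$ such that $\mathbb{E}[X]-M\le\beta bc/(c^2-1)$ for all $m>0$, $b>0$, $c>1$. -/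

import Mathlib

open MeasureTheory Set

noncomputable section

namespace McKay

/-- The modified Bessel function of the first kind `I_ν(x)`, for real order `ν` and `x > 0`,
given by its power series. -/
def besselI (ν x : ℝ) : ℝ :=
  ∑' k : ℕ, (x / 2) ^ (ν + 2 * (k : ℝ)) / (Real.Gamma (ν + (k : ℝ) + 1) * (k.factorial : ℝ))

/-- The density on `ℝ` of the McKay Type I distribution with parameters
`m > -1/2`, `b > 0`, `c > 1`; it vanishes outside `(0, ∞)`. -/
def mcKayPDF (m b c x : ℝ) : ℝ :=
  if 0 < x then
    Real.sqrt Real.pi * (c ^ 2 - 1) ^ (m + 1 / 2)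
        / ((2 : ℝ) ^ m * b ^ (m + 1) * Real.Gamma (m + 1 / 2))
      * x ^ m * Real.exp (-(c * x / b)) * besselI m (x / b)
  else 0

/-- The McKay Type I distribution, as a measure on `ℝ`. -/
def mcKayTypeI (m b c : ℝ) : Measure ℝ :=
  volume.withDensity fun x => ENNReal.ofReal (mcKayPDF m b c x)

/-- `a` is a mode of `μ` (in the sense of Khinchine): the distribution function
`x ↦ μ (-∞, x]` is convex on `(-∞, a)` and concave on `(a, ∞)`. -/
def IsMode (μ : Measure ℝ) (a : ℝ) : Prop :=
  ConvexOn ℝ (Iio a) (fun x => μ.real (Iic x)) ∧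
    ConcaveOn ℝ (Ioi a) (fun x => μ.real (Iic x))

/-- A distribution on `ℝ` is unimodal if it has a mode. -/
def IsUnimodal (μ : Measure ℝ) : Prop := ∃ a : ℝ, IsMode μ a

end McKay

end

/-! Write `I_ν(x) = (x/2)^ν F_ν(x²/4)` with `F_ν` entire (`besselEntire`). With `y = x/b`, the
density is a positive multiple of `y^(2m) e^(-cy) F_m(y²/4)`, and its derivative has the sign of
`pdfSlope`. The recurrence for `F` makes the derivative of `pdfSlope` a positive function times
`(2m-1)c - (c²-1)y` (`hasDerivAt_pdfSlope`), so on `[0, ∞)` the slope function starts at `m/Γ(m+1)`,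
rises at most once and then falls below zero. If `m ≤ 0` it is negative on `(0, ∞)` and the mode is
0. If `m > 0` it has a single zero `y₀`, beyond the turning point `(2m-1)c/(c²-1)`; this is the
outer lower bound for the mode `b y₀`.

At `y₀` the ratio `I_{m+1}/I_m` equals `c - 2m/y₀`. Monotonicity of this ratio
(`besselEntire_ratio_increasing`) and of its quotient by `x` (`besselEntire_turan`) become quadratic
inequalities in `y₀`, which give the upper bound and the alternative lower bound.

Integrating the series termwise with Legendre duplication gives total mass 1 and mean
`(2m+1)bc/(c²-1)`, so bounds on the mode transfer to mean minus mode. Sharpness: at `m = 1`, `c → 1`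
the square-root bound meets the outer lower bound; as `m → 0`, positivity of the mode suffices. -/

namespace McKay

/-! ### The entire factor of the Bessel function -/

/-- The entire function `t ↦ ∑ tᵏ / (Γ(ν + k + 1) k!)`, so that
`I_ν(x) = (x / 2) ^ ν * besselEntire ν (x² / 4)`. -/
noncomputable def besselEntire (ν t : ℝ) : ℝ :=
  ∑' k : ℕ, t ^ k / (Real.Gamma (ν + k + 1) * k.factorial)

lemma gamma_add_nat_pos {ν : ℝ} (hν : -1 < ν) (k : ℕ) : 0 < Real.Gamma (ν + k + 1) :=
  Real.Gamma_pos_of_pos (by have := k.cast_nonneg (α := ℝ); linarith)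

/-- Each step of the Gamma recurrence contributes a factor at least `ν + 1 > 0`. The geometric bound
lets an exponential series dominate `besselEntire`. -/
lemma inv_gamma_add_nat_le {ν : ℝ} (hν : -1 < ν) (k : ℕ) :
    (Real.Gamma (ν + k + 1))⁻¹ ≤ (Real.Gamma (ν + 1))⁻¹ * ((ν + 1)⁻¹) ^ k := by
  induction k with
  | zero => simp
  | succ k ih =>
    have hk := k.cast_nonneg (α := ℝ)
    have h1 : Real.Gamma (ν + (k + 1 : ℕ) + 1) = (ν + k + 1) * Real.Gamma (ν + k + 1) := by
      rw [← Real.Gamma_add_one (by linarith)]; push_cast; ring_nf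
    rw [h1, mul_inv, pow_succ, mul_comm, ← mul_assoc]
    have := gamma_add_nat_pos hν k
    have h0 : 0 < Real.Gamma (ν + 1) := Real.Gamma_pos_of_pos (by linarith)
    have h2 : 0 < ν + 1 := by linarith
    have h3 : 0 ≤ (ν + k + 1)⁻¹ := inv_nonneg.2 (by linarith)
    gcongr
    linarith

lemma summable_besselEntire {ν : ℝ} (hν : -1 < ν) (t : ℝ) :
    Summable fun k : ℕ => t ^ k / (Real.Gamma (ν + k + 1) * k.factorial) := by
  refine Summable.of_norm_bounded (g := fun k : ℕ =>
    (Real.Gamma (ν + 1))⁻¹ * ((|t| * (ν + 1)⁻¹) ^ k / k.factorial))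
    ((Real.summable_pow_div_factorial _).mul_left _) fun k => ?_
  have h := inv_gamma_add_nat_le hν k
  have hp := gamma_add_nat_pos hν k
  rw [Real.norm_eq_abs, abs_div, abs_pow, abs_of_pos (mul_pos hp (by positivity))]
  calc |t| ^ k / (Real.Gamma (ν + k + 1) * k.factorial)
      = (Real.Gamma (ν + k + 1))⁻¹ * (|t| ^ k / k.factorial) := by field_simp
    _ ≤ ((Real.Gamma (ν + 1))⁻¹ * ((ν + 1)⁻¹) ^ k) * (|t| ^ k / k.factorial) := by gcongr
    _ = _ := by rw [mul_pow]; ring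

lemma besselEntire_zero (ν : ℝ) : besselEntire ν 0 = (Real.Gamma (ν + 1))⁻¹ := by
  rw [besselEntire, tsum_eq_single 0 (fun k hk => by simp [hk])]
  simp

lemma inv_gamma_le_besselEntire {ν t : ℝ} (hν : -1 < ν) (ht : 0 ≤ t) :
    (Real.Gamma (ν + 1))⁻¹ ≤ besselEntire ν t := by
  have := (summable_besselEntire hν t).le_tsum 0 (fun k _ =>
    div_nonneg (pow_nonneg ht k) (mul_pos (gamma_add_nat_pos hν k) (by positivity)).le)
  simpa [besselEntire] using this

lemma besselEntire_pos {ν t : ℝ} (hν : -1 < ν) (ht : 0 ≤ t) : 0 < besselEntire ν t :=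
  lt_of_lt_of_le (inv_pos.2 (Real.Gamma_pos_of_pos (by linarith))) (inv_gamma_le_besselEntire hν ht)

/-- Termwise differentiation shifts the index by one, which raises the order by one. On the ball of
radius `R` the derived series is dominated by its own values at `R`. -/
lemma hasDerivAt_besselEntire {ν : ℝ} (hν : -1 < ν) (t : ℝ) :
    HasDerivAt (besselEntire ν) (besselEntire (ν + 1) t) t := by
  have hterm : ∀ (k : ℕ) (s : ℝ),
      ((k + 1 : ℕ) : ℝ) * s ^ k / (Real.Gamma (ν + (k + 1 : ℕ) + 1) * (k + 1).factorial)
        = s ^ k / (Real.Gamma (ν + 1 + k + 1) * k.factorial) := by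
    intro k s
    have h : ν + ((k + 1 : ℕ) : ℝ) + 1 = ν + 1 + k + 1 := by push_cast; ring
    have hp := gamma_add_nat_pos (show -1 < ν + 1 by linarith) k
    rw [h, Nat.factorial_succ]
    push_cast
    field_simp
  set R := |t| + 1
  have hR : 0 < R := by positivity
  have key := hasDerivAt_tsum_of_isPreconnected
    (g := fun (k : ℕ) (s : ℝ) => s ^ k / (Real.Gamma (ν + k + 1) * k.factorial))
    (g' := fun (k : ℕ) (s : ℝ) => (k : ℝ) * s ^ (k - 1) / (Real.Gamma (ν + k + 1) * k.factorial))
    (u := fun k : ℕ => (k : ℝ) * R ^ (k - 1) / (Real.Gamma (ν + k + 1) * k.factorial))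
    (t := Metric.ball 0 R) (y₀ := t) (y := t) ?_ Metric.isOpen_ball
    (convex_ball _ _).isPreconnected ?_ ?_ ?_ (summable_besselEntire hν t) ?_
  · refine key.congr_deriv ?_
    have hs : Summable fun k : ℕ =>
        (k : ℝ) * t ^ (k - 1) / (Real.Gamma (ν + k + 1) * k.factorial) := by
      rw [← summable_nat_add_iff 1]
      refine (summable_besselEntire (show -1 < ν + 1 by linarith) t).congr fun k => ?_
      exact (hterm k t).symm
    rw [hs.tsum_eq_zero_add]
    simp only [Nat.cast_zero, zero_mul, zero_div, zero_add, Nat.add_sub_cancel, hterm]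
    rfl
  · rw [← summable_nat_add_iff 1]
    refine (summable_besselEntire (show -1 < ν + 1 by linarith) R).congr fun k => ?_
    exact (hterm k R).symm
  · intro k s _
    exact (hasDerivAt_pow k s).div_const _
  · intro k s hs
    have hs' : |s| ≤ R := by simpa using (Metric.mem_ball.1 hs).le
    have hp := gamma_add_nat_pos hν k
    rw [Real.norm_eq_abs, abs_div, abs_mul, abs_pow, Nat.abs_cast,
      abs_of_pos (mul_pos hp (by positivity))]
    gcongr
  · simp [R]
  · simp [R]

lemma continuous_besselEntire {ν : ℝ} (hν : -1 < ν) : Continuous (besselEntire ν) :=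
  continuous_iff_continuousAt.2 fun t => (hasDerivAt_besselEntire hν t).continuousAt

/-- The three-term recurrence `I_ν - I_{ν+2} = (2 (ν + 1) / x) I_{ν+1}`. -/
lemma besselEntire_recurrence {ν : ℝ} (hν : -1 < ν) (t : ℝ) :
    besselEntire ν t = (ν + 1) * besselEntire (ν + 1) t + t * besselEntire (ν + 2) t := by
  have h0 := summable_besselEntire hν t
  have h1 := summable_besselEntire (show -1 < ν + 1 by linarith) t
  have h2 := summable_besselEntire (show -1 < ν + 2 by linarith) t
  -- Since `1/Γ(ν+k+1) = (ν+k+1)/Γ(ν+k+2)`, removing `ν + 1` leaves the factor `k`, which cancels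
  -- into `k!` and shifts the series.
  have e : ∀ k : ℕ, t ^ k / (Real.Gamma (ν + k + 1) * k.factorial)
      - (ν + 1) * (t ^ k / (Real.Gamma (ν + 1 + k + 1) * k.factorial))
      = k * (t ^ k / (Real.Gamma (ν + 1 + k + 1) * k.factorial)) := by
    intro k
    have hk := k.cast_nonneg (α := ℝ)
    have hp := gamma_add_nat_pos hν k
    have hne : ν + k + 1 ≠ 0 := by linarith
    have : Real.Gamma (ν + 1 + k + 1) = (ν + k + 1) * Real.Gamma (ν + k + 1) := by
      rw [← Real.Gamma_add_one hne]; ring_nf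
    rw [this]
    field_simp
    ring
  have e2 : besselEntire ν t - (ν + 1) * besselEntire (ν + 1) t
      = ∑' k : ℕ, (k : ℝ) * (t ^ k / (Real.Gamma (ν + 1 + k + 1) * k.factorial)) := by
    unfold besselEntire
    rw [← tsum_mul_left, ← h0.tsum_sub (h1.mul_left (ν + 1))]
    exact tsum_congr e
  have hs' := (summable_congr e).1 (h0.sub (h1.mul_left (ν + 1)))
  rw [hs'.tsum_eq_zero_add] at e2
  have e3 : ∀ k : ℕ, ((k + 1 : ℕ) : ℝ) *
      (t ^ (k + 1) / (Real.Gamma (ν + 1 + (k + 1 : ℕ) + 1) * (k + 1).factorial))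
      = t * (t ^ k / (Real.Gamma (ν + 2 + k + 1) * k.factorial)) := by
    intro k
    have h : ν + 1 + ((k + 1 : ℕ) : ℝ) + 1 = ν + 2 + k + 1 := by push_cast; ring
    have hp := gamma_add_nat_pos (show -1 < ν + 2 by linarith) k
    rw [h, Nat.factorial_succ]
    push_cast
    field_simp
    ring
  simp only [e3, Nat.cast_zero, zero_mul, zero_add, tsum_mul_left] at e2
  have : besselEntire (ν + 2) t =
      ∑' k : ℕ, t ^ k / (Real.Gamma (ν + 2 + k + 1) * k.factorial) := rfl
  rw [this]
  linarith

lemma besselI_eq {ν x : ℝ} (hx : 0 < x) :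
    besselI ν x = (x / 2) ^ ν * besselEntire ν (x ^ 2 / 4) := by
  unfold besselI besselEntire
  rw [← tsum_mul_left]
  refine tsum_congr fun k => ?_
  rw [Real.rpow_add (by positivity), Real.rpow_mul (by positivity), Real.rpow_natCast,
    show (x / 2) ^ (2 : ℝ) = x ^ 2 / 4 by rw [Real.rpow_two]; ring]
  ring

/-! ### Monotonicity of Bessel ratios -/

/-- `t ^ (ν + 1 / 2) (2 (F_ν² - t F_{ν+1}²) - (2 ν + 1) F_ν F_{ν+1})` increases, which says that
`I_{ν+1} / I_ν` is increasing. -/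
lemma besselEntire_ratio_increasing {ν t : ℝ} (hν : -1 / 2 < ν) (ht : 0 < t) :
    0 < 2 * (besselEntire ν t ^ 2 - t * besselEntire (ν + 1) t ^ 2)
      - (2 * ν + 1) * (besselEntire ν t * besselEntire (ν + 1) t) := by
  have hν' : -1 < ν := by linarith
  set g : ℝ → ℝ := fun t => 2 * (besselEntire ν t ^ 2 - t * besselEntire (ν + 1) t ^ 2)
      - (2 * ν + 1) * (besselEntire ν t * besselEntire (ν + 1) t) with hg
  have hgd : ∀ t, HasDerivAt g (2 * (2 * besselEntire ν t * besselEntire (ν + 1) t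
      - (besselEntire (ν + 1) t ^ 2
        + t * (2 * besselEntire (ν + 1) t * besselEntire (ν + 2) t)))
      - (2 * ν + 1) * (besselEntire (ν + 1) t * besselEntire (ν + 1) t
        + besselEntire ν t * besselEntire (ν + 2) t)) t := by
    intro t
    have hP := hasDerivAt_besselEntire hν' t
    have hQ := hasDerivAt_besselEntire (show -1 < ν + 1 by linarith) t
    rw [show ν + 1 + 1 = ν + 2 by ring] at hQ
    refine ((((hP.pow 2).sub ((hasDerivAt_id t).mul (hQ.pow 2))).const_mul 2).sub
      ((hP.mul hQ).const_mul (2 * ν + 1))).congr_deriv ?_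
    simp
  -- The weight `t^(ν+1/2)` vanishes at 0, and after eliminating `F_{ν+2}` by the recurrence the
  -- derivative is just `t^(ν-1/2) (ν+1/2) F_ν F_{ν+1}`.
  have hmono : StrictMonoOn (fun t : ℝ => t ^ (ν + 1 / 2) * g t) (Ici 0) := by
    refine strictMonoOn_of_deriv_pos (convex_Ici 0) ?_ ?_
    · exact ((Real.continuous_rpow_const (by linarith)).mul
        (continuous_iff_continuousAt.2 fun t => (hgd t).continuousAt)).continuousOn
    · intro t ht
      rw [interior_Ici, mem_Ioi] at ht
      have hd := (Real.hasDerivAt_rpow_const (p := ν + 1 / 2) (Or.inl ht.ne')).mul (hgd t)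
      have hP := besselEntire_pos hν' ht.le
      have hQ := besselEntire_pos (show -1 < ν + 1 by linarith) ht.le
      have hrec := besselEntire_recurrence hν' t
      have hd' := hd.deriv
      rw [show (fun t : ℝ => t ^ (ν + 1 / 2) * g t) = (fun t : ℝ => t ^ (ν + 1 / 2)) * g from rfl,
        hd', show ν + 1 / 2 = (ν + 1 / 2 - 1) + 1 by ring, Real.rpow_add_one ht.ne']
      have hpow := Real.rpow_pos_of_pos ht (ν + 1 / 2 - 1)
      have : 0 < t ^ (ν + 1 / 2 - 1) * ((2 * ν + 1) / 2 * (besselEntire ν t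
          * besselEntire (ν + 1) t)) := by
        have : 0 < 2 * ν + 1 := by linarith
        positivity
      refine this.trans_eq ?_
      simp only [hg, add_sub_cancel_right]
      set P := besselEntire ν t
      set Q := besselEntire (ν + 1) t
      set R := besselEntire (ν + 2) t
      have hR : t * R = P - (ν + 1) * Q := by linarith
      linear_combination (-(t ^ (ν + 1 / 2 - 1) * (-4 * t * Q - (2 * ν + 1) * P))) * hR
  have h := hmono (mem_Ici.2 le_rfl) (mem_Ici.2 ht.le) ht
  simp only [Real.zero_rpow (show ν + 1 / 2 ≠ 0 by linarith), zero_mul] at h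
  exact (mul_pos_iff_of_pos_left (Real.rpow_pos_of_pos ht _)).1 h

/-- A Turán-type inequality: `I_{ν+1} / (x I_ν)` is decreasing. -/
lemma besselEntire_turan {ν t : ℝ} (hν : -1 < ν) (ht : 0 < t) :
    0 < t * besselEntire (ν + 1) t ^ 2 + (ν + 1) * (besselEntire ν t * besselEntire (ν + 1) t)
      - besselEntire ν t ^ 2 := by
  set g : ℝ → ℝ := fun t => t * besselEntire (ν + 1) t ^ 2
      + (ν + 1) * (besselEntire ν t * besselEntire (ν + 1) t) - besselEntire ν t ^ 2 with hg
  have hgd : ∀ t, HasDerivAt g ((besselEntire (ν + 1) t ^ 2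
        + t * (2 * besselEntire (ν + 1) t * besselEntire (ν + 2) t))
      + (ν + 1) * (besselEntire (ν + 1) t * besselEntire (ν + 1) t
        + besselEntire ν t * besselEntire (ν + 2) t)
      - 2 * besselEntire ν t * besselEntire (ν + 1) t) t := by
    intro t
    have hP := hasDerivAt_besselEntire hν t
    have hQ := hasDerivAt_besselEntire (show -1 < ν + 1 by linarith) t
    rw [show ν + 1 + 1 = ν + 2 by ring] at hQ
    refine ((((hasDerivAt_id t).mul (hQ.pow 2)).add ((hP.mul hQ).const_mul (ν + 1))).sub
      (hP.pow 2)).congr_deriv ?_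
    simp
  -- Here the weight `t^(ν+1)` reduces the derivative to `t^(ν+1) F_{ν+1}²`.
  have hmono : StrictMonoOn (fun t : ℝ => t ^ (ν + 1) * g t) (Ici 0) := by
    refine strictMonoOn_of_deriv_pos (convex_Ici 0) ?_ ?_
    · exact ((Real.continuous_rpow_const (by linarith)).mul
        (continuous_iff_continuousAt.2 fun t => (hgd t).continuousAt)).continuousOn
    · intro t ht
      rw [interior_Ici, mem_Ioi] at ht
      have hd := (Real.hasDerivAt_rpow_const (p := ν + 1) (Or.inl ht.ne')).mul (hgd t)
      have hQ := besselEntire_pos (show -1 < ν + 1 by linarith) ht.le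
      have hrec := besselEntire_recurrence hν t
      rw [show (fun t : ℝ => t ^ (ν + 1) * g t) = (fun t : ℝ => t ^ (ν + 1)) * g from rfl,
        hd.deriv, Real.rpow_add_one ht.ne', add_sub_cancel_right]
      have hpow := Real.rpow_pos_of_pos ht ν
      have : 0 < t ^ ν * (t * besselEntire (ν + 1) t ^ 2) := by positivity
      refine this.trans_eq ?_
      simp only [hg]
      set P := besselEntire ν t
      set Q := besselEntire (ν + 1) t
      set R := besselEntire (ν + 2) t
      have hR : t * R = P - (ν + 1) * Q := by linarith
      linear_combination (-(t ^ ν * (2 * t * Q + (ν + 1) * P))) * hR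
  have h := hmono (mem_Ici.2 le_rfl) (mem_Ici.2 ht.le) ht
  simp only [Real.zero_rpow (show ν + 1 ≠ 0 by linarith), zero_mul] at h
  exact (mul_pos_iff_of_pos_left (Real.rpow_pos_of_pos ht _)).1 h

/-! ### The sign of the derivative of the density -/

/-- The McKay Type I density with `b = 1`, up to a constant factor. -/
noncomputable def unscaledPDF (m c y : ℝ) : ℝ :=
  y ^ (2 * m) * Real.exp (-(c * y)) * besselEntire m (y ^ 2 / 4)

/-- A positive multiple of `x ^ (1 - m) e ^ (c x) (I_{m-1}(x) - c I_m(x))`; it has the sign of the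
derivative of the density. -/
noncomputable def pdfSlope (m c y : ℝ) : ℝ :=
  Real.exp (c * y) * (m * besselEntire m (y ^ 2 / 4) + y ^ 2 / 4 * besselEntire (m + 1) (y ^ 2 / 4)
    - c * (y / 2) * besselEntire m (y ^ 2 / 4))

lemma hasDerivAt_besselEntire_comp {ν : ℝ} (hν : -1 < ν) (y : ℝ) :
    HasDerivAt (fun y => besselEntire ν (y ^ 2 / 4))
      (y / 2 * besselEntire (ν + 1) (y ^ 2 / 4)) y := by
  have h : HasDerivAt (fun y : ℝ => y ^ 2 / 4) (y / 2) y :=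
    ((hasDerivAt_pow 2 y).div_const 4).congr_deriv (by push_cast; ring)
  exact ((hasDerivAt_besselEntire hν (y ^ 2 / 4)).comp y h).congr_deriv (mul_comm _ _)

lemma hasDerivAt_unscaledPDF {m c y : ℝ} (hm : -1 < m) (hy : 0 < y) :
    HasDerivAt (unscaledPDF m c)
      (2 * y ^ (2 * m - 1) * Real.exp (-(2 * (c * y))) * pdfSlope m c y) y := by
  have h1 := Real.hasDerivAt_rpow_const (p := 2 * m) (Or.inl hy.ne')
  have h2 : HasDerivAt (fun y => Real.exp (-(c * y))) (Real.exp (-(c * y)) * -(c * 1)) y :=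
    ((hasDerivAt_id y).const_mul c).neg.exp
  refine ((h1.mul h2).mul (hasDerivAt_besselEntire_comp hm y)).congr_deriv ?_
  have e1 : y ^ (2 * m) = y ^ (2 * m - 1) * y := by
    rw [← Real.rpow_add_one hy.ne']; ring_nf
  have e2 : Real.exp (-(2 * (c * y))) * Real.exp (c * y) = Real.exp (-(c * y)) := by
    rw [← Real.exp_add]; ring_nf
  simp only [Pi.mul_apply, pdfSlope, e1]
  linear_combination (-(2 * y ^ (2 * m - 1) * (m * besselEntire m (y ^ 2 / 4)
    + y ^ 2 / 4 * besselEntire (m + 1) (y ^ 2 / 4)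
    - c * (y / 2) * besselEntire m (y ^ 2 / 4)))) * e2

/-- The factor `e^(cy)` is chosen so that, once the recurrence removes `F_{m+2}`, all `F_{m+1}`
terms cancel and a linear factor times `F_m` remains. -/
lemma hasDerivAt_pdfSlope {m c : ℝ} (hm : -1 < m) (y : ℝ) :
    HasDerivAt (pdfSlope m c) (Real.exp (c * y) * besselEntire m (y ^ 2 / 4) / 2
      * ((2 * m - 1) * c - (c ^ 2 - 1) * y)) y := by
  have h2 : HasDerivAt (fun y => Real.exp (c * y)) (Real.exp (c * y) * (c * 1)) y :=
    ((hasDerivAt_id y).const_mul c).exp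
  have h3 : HasDerivAt (fun y : ℝ => y ^ 2 / 4) (y / 2) y :=
    ((hasDerivAt_pow 2 y).div_const 4).congr_deriv (by push_cast; ring)
  have h4 : HasDerivAt (fun y : ℝ => c * (y / 2)) (c * (1 / 2)) y :=
    ((hasDerivAt_id y).div_const 2).const_mul c
  have hP := hasDerivAt_besselEntire_comp hm y
  have hQ := hasDerivAt_besselEntire_comp (show -1 < m + 1 by linarith) y
  rw [show m + 1 + 1 = m + 2 by ring] at hQ
  have hrec := besselEntire_recurrence hm (y ^ 2 / 4)
  refine (h2.mul (((hP.const_mul m).add (h3.mul hQ)).sub (h4.mul hP))).congr_deriv ?_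
  simp only [Pi.mul_apply, Pi.add_apply, Pi.sub_apply]
  linear_combination (-(Real.exp (c * y) * y / 2)) * hrec

lemma continuous_pdfSlope {m c : ℝ} (hm : -1 < m) : Continuous (pdfSlope m c) :=
  continuous_iff_continuousAt.2 fun y => (hasDerivAt_pdfSlope hm y).continuousAt

lemma pdfSlope_zero (m c : ℝ) : pdfSlope m c 0 = m * (Real.Gamma (m + 1))⁻¹ := by
  simp [pdfSlope, besselEntire_zero]

lemma strictAntiOn_pdfSlope {m c a : ℝ} (hm : -1 < m) (hc : 1 < c)
    (ha : (2 * m - 1) * c ≤ (c ^ 2 - 1) * a) : StrictAntiOn (pdfSlope m c) (Ici a) := by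
  refine strictAntiOn_of_deriv_neg (convex_Ici a) (continuous_pdfSlope hm).continuousOn ?_
  intro y hy
  rw [interior_Ici, mem_Ioi] at hy
  rw [(hasDerivAt_pdfSlope hm y).deriv]
  have hP := besselEntire_pos hm (show 0 ≤ y ^ 2 / 4 by positivity)
  have hd : 0 < c ^ 2 - 1 := by nlinarith
  refine mul_neg_of_pos_of_neg (by positivity) ?_
  nlinarith

lemma strictMonoOn_pdfSlope {m c a : ℝ} (hm : -1 < m) (hc : 1 < c)
    (ha : (c ^ 2 - 1) * a ≤ (2 * m - 1) * c) : StrictMonoOn (pdfSlope m c) (Iic a) := by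
  refine strictMonoOn_of_deriv_pos (convex_Iic a) (continuous_pdfSlope hm).continuousOn ?_
  intro y hy
  rw [interior_Iic, mem_Iio] at hy
  rw [(hasDerivAt_pdfSlope hm y).deriv]
  have hP := besselEntire_pos hm (show 0 ≤ y ^ 2 / 4 by positivity)
  have hd : 0 < c ^ 2 - 1 := by nlinarith
  refine mul_pos (by positivity) ?_
  nlinarith

lemma pdfSlope_neg {m c y : ℝ} (hm : -1 < m) (hm0 : m ≤ 0) (hc : 1 < c) (hy : 0 < y) :
    pdfSlope m c y < 0 := by
  have h := strictAntiOn_pdfSlope hm hc (a := 0) (by nlinarith)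
    (mem_Ici.2 le_rfl) (mem_Ici.2 hy.le) hy
  refine h.trans_le ?_
  rw [pdfSlope_zero]
  exact mul_nonpos_of_nonpos_of_nonneg hm0
    (inv_nonneg.2 (Real.Gamma_pos_of_pos (by linarith)).le)

/-- Beyond `a + 1` the derivative is at most `-K`, because `F_m ≥ 1/Γ(m+1)`, the exponential is at
least 1 and the linear factor is at most `-(c²-1)`; linear decay follows. -/
lemma exists_pdfSlope_neg {m c a : ℝ} (hm : -1 < m) (hc : 1 < c) (ha0 : 0 ≤ a)
    (ha : (2 * m - 1) * c ≤ (c ^ 2 - 1) * a) : ∃ y, a < y ∧ pdfSlope m c y < 0 := by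
  have hG : 0 < (Real.Gamma (m + 1))⁻¹ := inv_pos.2 (Real.Gamma_pos_of_pos (by linarith))
  have hd : 0 < c ^ 2 - 1 := by nlinarith
  set K := (Real.Gamma (m + 1))⁻¹ / 2 * (c ^ 2 - 1)
  have hK : 0 < K := by positivity
  have hle : ∀ y, a + 1 ≤ y → pdfSlope m c y - pdfSlope m c (a + 1) ≤ -K * (y - (a + 1)) := by
    intro y hy
    refine (convex_Ici (a + 1)).image_sub_le_mul_sub_of_deriv_le
      (continuous_pdfSlope hm).continuousOn
      (fun y _ => (hasDerivAt_pdfSlope hm y).differentiableAt.differentiableWithinAt) ?_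
      _ (mem_Ici.2 le_rfl) _ (mem_Ici.2 hy) hy
    intro z hz
    rw [interior_Ici, mem_Ioi] at hz
    rw [(hasDerivAt_pdfSlope hm z).deriv]
    have h1 := inv_gamma_le_besselEntire hm (show 0 ≤ z ^ 2 / 4 by positivity)
    have h2 : 1 ≤ Real.exp (c * z) := Real.one_le_exp (by nlinarith)
    have h3 : (c ^ 2 - 1) ≤ (c ^ 2 - 1) * z - (2 * m - 1) * c := by nlinarith
    have h4 : (Real.Gamma (m + 1))⁻¹ ≤ Real.exp (c * z) * besselEntire m (z ^ 2 / 4) := by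
      nlinarith
    have : K ≤ Real.exp (c * z) * besselEntire m (z ^ 2 / 4) / 2
        * ((c ^ 2 - 1) * z - (2 * m - 1) * c) := by
      have := hG.trans_le h4
      simp only [K]
      gcongr
    linarith
  set S := |pdfSlope m c (a + 1)| + 1
  have hS : 0 < S := by positivity
  have hSK : 0 < S / K := by positivity
  refine ⟨a + 1 + S / K, by linarith, ?_⟩
  have h := hle (a + 1 + S / K) (by linarith)
  have : -K * (a + 1 + S / K - (a + 1)) = -S := by field_simp; ring
  rw [this] at h
  have := le_abs_self (pdfSlope m c (a + 1))
  simp only [S] at h ⊢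
  linarith

/-- For `m > 0` the density has exactly one critical point, where it changes from increasing to
decreasing. -/
lemma exists_pdfSlope_sign_change {m c : ℝ} (hm : 0 < m) (hc : 1 < c) :
    ∃ y₀, 0 < y₀ ∧ (2 * m - 1) * c < (c ^ 2 - 1) * y₀ ∧ pdfSlope m c y₀ = 0 ∧
      (∀ y, 0 < y → y < y₀ → 0 < pdfSlope m c y) ∧ ∀ y, y₀ < y → pdfSlope m c y < 0 := by
  have hm1 : -1 < m := by linarith
  have hd : 0 < c ^ 2 - 1 := by nlinarith
  have h0 : 0 < pdfSlope m c 0 := by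
    rw [pdfSlope_zero]
    exact mul_pos hm (inv_pos.2 (Real.Gamma_pos_of_pos (by linarith)))
  -- The turning point of `pdfSlope`, clipped to the half-line `[0, ∞)`.
  set a := max 0 ((2 * m - 1) * c / (c ^ 2 - 1)) with ha
  have ha0 : 0 ≤ a := le_max_left _ _
  have ha1 : (2 * m - 1) * c ≤ (c ^ 2 - 1) * a := by
    have := le_max_right 0 ((2 * m - 1) * c / (c ^ 2 - 1))
    rw [div_le_iff₀ hd] at this
    linarith
  have hpos : ∀ y, 0 ≤ y → y ≤ a → 0 < pdfSlope m c y := by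
    intro y hy hya
    rcases hy.eq_or_lt with rfl | hy
    · exact h0
    have ha2 : a = (2 * m - 1) * c / (c ^ 2 - 1) := by
      rcases max_choice 0 ((2 * m - 1) * c / (c ^ 2 - 1)) with h | h
      · exact absurd (ha.trans h) (by linarith)
      · exact ha.trans h
    have hle : (c ^ 2 - 1) * a ≤ (2 * m - 1) * c := by
      rw [ha2, mul_div_cancel₀ _ hd.ne']
    exact h0.trans (strictMonoOn_pdfSlope hm1 hc hle (mem_Iic.2 ha0) (mem_Iic.2 hya) hy)
  have hanti := strictAntiOn_pdfSlope hm1 hc ha1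
  obtain ⟨Y, hY, hYneg⟩ := exists_pdfSlope_neg hm1 hc ha0 ha1
  obtain ⟨y₀, ⟨hy1, hy2⟩, hy0⟩ := intermediate_value_Icc' hY.le
    (continuous_pdfSlope hm1 (c := c)).continuousOn ⟨hYneg.le, (hpos a ha0 le_rfl).le⟩
  -- The slope is still positive at the turning point, so its zero lies strictly beyond; hence the
  -- strict lower bound for the mode.
  have hay : a < y₀ := lt_of_le_of_ne hy1 fun h => by
    have := hpos a ha0 le_rfl
    rw [h, hy0] at this
    exact lt_irrefl _ this
  refine ⟨y₀, by linarith, by nlinarith, hy0, fun y hy hyy => ?_, fun y hy => ?_⟩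
  · rcases le_total y a with h | h
    · exact hpos y hy.le h
    · have := hanti (mem_Ici.2 h) (mem_Ici.2 hay.le) hyy
      rwa [hy0] at this
  · have := hanti (mem_Ici.2 hay.le) (mem_Ici.2 (hay.trans hy).le) hy
    rwa [hy0] at this

/-! ### Quadratic inequalities locating the critical point -/

/-- A zero of the slope fixes `F_{m+1}/F_m` as an explicit function of `y`; substituting it turns
the ratio inequality into one in `y` alone. -/
lemma quadratic_neg_of_pdfSlope_eq_zero {m c y : ℝ} (hm : -1 / 2 < m) (hy : 0 < y)
    (h : pdfSlope m c y = 0) : (c ^ 2 - 1) * y ^ 2 - (2 * m - 1) * c * y - 2 * m < 0 := by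
  have ht : 0 < y ^ 2 / 4 := by positivity
  have hP := besselEntire_pos (show -1 < m by linarith) ht.le
  have hineq := mul_pos ht (besselEntire_ratio_increasing hm ht)
  have h' := (mul_eq_zero.1 h).resolve_left (Real.exp_pos _).ne'
  set P := besselEntire m (y ^ 2 / 4)
  set Q := besselEntire (m + 1) (y ^ 2 / 4)
  have hQ : y ^ 2 / 4 * Q = (c * y / 2 - m) * P := by linear_combination h'
  have e : y ^ 2 / 4 * (2 * (P ^ 2 - y ^ 2 / 4 * Q ^ 2) - (2 * m + 1) * (P * Q))
      = P ^ 2 / 2 * -((c ^ 2 - 1) * y ^ 2 - (2 * m - 1) * c * y - 2 * m) := by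
    linear_combination (-2 * (y ^ 2 / 4 * Q + (c * y / 2 - m) * P) - (2 * m + 1) * P) * hQ
  rw [e] at hineq
  have := (mul_pos_iff_of_pos_left (by positivity)).1 hineq
  linarith

lemma quadratic_pos_of_pdfSlope_eq_zero {m c y : ℝ} (hm : -1 < m) (hy : 0 < y)
    (h : pdfSlope m c y = 0) : 0 < (c ^ 2 - 1) * y ^ 2 - 2 * (m - 1) * c * y - 4 * m := by
  have ht : 0 < y ^ 2 / 4 := by positivity
  have hP := besselEntire_pos hm ht.le
  have hineq := mul_pos ht (besselEntire_turan hm ht)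
  have h' := (mul_eq_zero.1 h).resolve_left (Real.exp_pos _).ne'
  set P := besselEntire m (y ^ 2 / 4)
  set Q := besselEntire (m + 1) (y ^ 2 / 4)
  have hQ : y ^ 2 / 4 * Q = (c * y / 2 - m) * P := by linear_combination h'
  have e : y ^ 2 / 4 * (y ^ 2 / 4 * Q ^ 2 + (m + 1) * (P * Q) - P ^ 2)
      = P ^ 2 / 4 * ((c ^ 2 - 1) * y ^ 2 - 2 * (m - 1) * c * y - 4 * m) := by
    linear_combination ((y ^ 2 / 4 * Q + (c * y / 2 - m) * P) + (m + 1) * P) * hQ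
  rw [e] at hineq
  exact (mul_pos_iff_of_pos_left (by positivity)).1 hineq

lemma critical_point_lt {m c y : ℝ} (hm : -1 / 2 < m) (hc : 1 < c) (hy : 0 < y)
    (h : pdfSlope m c y = 0) :
    y < c / (c ^ 2 - 1) * (m - 1 / 2 + Real.sqrt ((m + 1 / 2) ^ 2 - 2 * m / c ^ 2)) := by
  have hd : 0 < c ^ 2 - 1 := by nlinarith
  have hc0 : 0 < c := by linarith
  have hq := quadratic_neg_of_pdfSlope_eq_zero hm hy h
  -- In the unit `c/(c²-1)` the quadratic becomes a completed square.
  obtain ⟨z, rfl⟩ : ∃ z, y = c / (c ^ 2 - 1) * z := ⟨(c ^ 2 - 1) / c * y, by field_simp⟩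
  refine mul_lt_mul_of_pos_left ?_ (by positivity)
  rw [← sub_lt_iff_lt_add']
  refine Real.lt_sqrt_of_sq_lt ?_
  have e : (z - (m - 1 / 2)) ^ 2 - ((m + 1 / 2) ^ 2 - 2 * m / c ^ 2)
      = (c ^ 2 - 1) / c ^ 2 * ((c ^ 2 - 1) * (c / (c ^ 2 - 1) * z) ^ 2
        - (2 * m - 1) * c * (c / (c ^ 2 - 1) * z) - 2 * m) := by
    field_simp
    ring
  have := mul_neg_of_pos_of_neg (show 0 < (c ^ 2 - 1) / c ^ 2 by positivity) hq
  linarith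

lemma lt_critical_point {m c y : ℝ} (hm : 0 < m) (hc : 1 < c) (hy : 0 < y)
    (h : pdfSlope m c y = 0) :
    c / (c ^ 2 - 1) * (m - 1 + Real.sqrt ((m - 1) ^ 2 + 4 * (c ^ 2 - 1) * m / c ^ 2)) < y := by
  have hd : 0 < c ^ 2 - 1 := by nlinarith
  have hc0 : 0 < c := by linarith
  have hq := quadratic_pos_of_pdfSlope_eq_zero (by linarith) hy h
  obtain ⟨z, rfl⟩ : ∃ z, y = c / (c ^ 2 - 1) * z := ⟨(c ^ 2 - 1) / c * y, by field_simp⟩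
  have hz : 0 < z := (mul_pos_iff_of_pos_left (by positivity)).1 hy
  refine mul_lt_mul_of_pos_left ?_ (by positivity)
  have e : (z - (m - 1)) ^ 2 - ((m - 1) ^ 2 + 4 * (c ^ 2 - 1) * m / c ^ 2)
      = (c ^ 2 - 1) / c ^ 2 * ((c ^ 2 - 1) * (c / (c ^ 2 - 1) * z) ^ 2
        - 2 * (m - 1) * c * (c / (c ^ 2 - 1) * z) - 4 * m) := by
    field_simp
    ring
  have h1 := mul_pos (show 0 < (c ^ 2 - 1) / c ^ 2 by positivity) hq
  -- The quadratic is positive also below its smaller root. That case is excluded: `0 < z ≤ m - 1`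
  -- would make the square smaller than `(m-1)²`.
  have h2 : 0 < 4 * (c ^ 2 - 1) * m / c ^ 2 := by positivity
  have h3 : 0 < z - (m - 1) := by nlinarith
  have := (Real.sqrt_lt' h3).2 (show (m - 1) ^ 2 + 4 * (c ^ 2 - 1) * m / c ^ 2
    < (z - (m - 1)) ^ 2 by linarith)
  linarith

/-! ### Monotonicity of the unscaled density -/

lemma strictMonoOn_unscaledPDF {m c y₀ : ℝ} (hm : -1 < m)
    (h : ∀ y, 0 < y → y < y₀ → 0 < pdfSlope m c y) :
    StrictMonoOn (unscaledPDF m c) (Ioc 0 y₀) := by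
  refine strictMonoOn_of_deriv_pos (convex_Ioc _ _)
    (fun y hy => (hasDerivAt_unscaledPDF hm hy.1).continuousAt.continuousWithinAt) ?_
  intro y hy
  rw [interior_Ioc] at hy
  rw [(hasDerivAt_unscaledPDF hm hy.1).deriv]
  have := Real.rpow_pos_of_pos hy.1 (2 * m - 1)
  exact mul_pos (by positivity) (h y hy.1 hy.2)

lemma strictAntiOn_unscaledPDF {m c y₀ : ℝ} (hm : -1 < m) (hy₀ : 0 < y₀)
    (h : ∀ y, y₀ < y → pdfSlope m c y < 0) :
    StrictAntiOn (unscaledPDF m c) (Ici y₀) := by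
  have hpos : ∀ y ∈ Ici y₀, 0 < y := fun y hy => hy₀.trans_le hy
  refine strictAntiOn_of_deriv_neg (convex_Ici _)
    (fun y hy => (hasDerivAt_unscaledPDF hm (hpos y hy)).continuousAt.continuousWithinAt) ?_
  intro y hy
  have hy' := hpos y (interior_subset hy)
  rw [interior_Ici] at hy
  rw [(hasDerivAt_unscaledPDF hm hy').deriv]
  have := Real.rpow_pos_of_pos hy' (2 * m - 1)
  exact mul_neg_of_pos_of_neg (by positivity) (h y hy)

lemma strictAntiOn_unscaledPDF_Ioi {m c : ℝ} (hm : -1 < m)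
    (h : ∀ y, 0 < y → pdfSlope m c y < 0) : StrictAntiOn (unscaledPDF m c) (Ioi 0) :=
  fun _ hx _ _ hxy => strictAntiOn_unscaledPDF hm hx (fun y hy => h y (lt_trans hx hy))
    (mem_Ici.2 le_rfl) (mem_Ici.2 hxy.le) hxy

/-! ### Total mass and first moment -/

/-- Termwise integration of a series of nonnegative functions. -/
lemma integrableOn_and_integral_eq_of_hasSum {f : ℕ → ℝ → ℝ} {g : ℝ → ℝ} {s : Set ℝ} {S : ℝ}
    (hs : MeasurableSet s) (hf : ∀ k, IntegrableOn (f k) s) (hf0 : ∀ k, ∀ x ∈ s, 0 ≤ f k x)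
    (hg : AEStronglyMeasurable g (volume.restrict s))
    (hsum : ∀ x ∈ s, HasSum (fun k => f k x) (g x))
    (hS : HasSum (fun k => ∫ x in s, f k x) S) :
    IntegrableOn g s ∧ ∫ x in s, g x = S := by
  have hnorm : ∀ k, ∫ x in s, ‖f k x‖ = ∫ x in s, f k x := fun k =>
    setIntegral_congr_fun hs fun x hx => Real.norm_of_nonneg (hf0 k x hx)
  have hint : ∫ x in s, g x = ∫ x in s, ∑' k, f k x :=
    setIntegral_congr_fun hs fun x hx => (hsum x hx).tsum_eq.symm
  refine ⟨⟨hg, ?_⟩, ?_⟩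
  · rw [HasFiniteIntegral]
    have h1 : ∫⁻ x in s, ‖g x‖ₑ = ∫⁻ x in s, ∑' k, ENNReal.ofReal (f k x) := by
      refine setLIntegral_congr_fun hs fun x hx => ?_
      rw [← ENNReal.ofReal_tsum_of_nonneg (fun k => hf0 k x hx) (hsum x hx).summable,
        (hsum x hx).tsum_eq, Real.enorm_of_nonneg ((hsum x hx).nonneg fun k => hf0 k x hx)]
    have hi0 : ∀ k, 0 ≤ ∫ x in s, f k x := fun k => setIntegral_nonneg hs (hf0 k)
    rw [h1, lintegral_tsum fun k => (hf k).aestronglyMeasurable.aemeasurable.ennreal_ofReal]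
    have h2 : ∀ k, ∫⁻ x in s, ENNReal.ofReal (f k x) = ENNReal.ofReal (∫ x in s, f k x) :=
      fun k => (ofReal_integral_eq_lintegral_ofReal (hf k)
        ((ae_restrict_iff' hs).2 (ae_of_all _ (hf0 k)))).symm
    simp only [h2]
    rw [← ENNReal.ofReal_tsum_of_nonneg hi0 hS.summable]
    exact ENNReal.ofReal_lt_top
  · rw [hint]
    refine (hasSum_integral_of_summable_integral_norm hf ?_).unique hS
    simpa only [hnorm] using hS.summable

/-- The binomial series of `(1-z)^(-q)`, with `Γ(q)` absorbed into the rising factorials. -/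
lemma hasSum_gamma_mul_pow {q z : ℝ} (hq : 0 < q) (hz0 : 0 ≤ z) (hz : z < 1) :
    HasSum (fun k : ℕ => Real.Gamma (q + k) / k.factorial * z ^ k)
      (Real.Gamma q * (1 - z) ^ (-q)) := by
  have h := (Real.one_div_one_sub_rpow_hasFPowerSeriesOnBall_zero q).hasSum (y := z)
    (by simpa [enorm_eq_nnnorm, Real.nnnorm_of_nonneg hz0, ← NNReal.coe_lt_one] using hz)
  have hG : ∀ k : ℕ, (ascPochhammer ℝ k).eval q * Real.Gamma q = Real.Gamma (q + k) := by
    intro k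
    induction k with
    | zero => simp
    | succ k ih =>
      rw [ascPochhammer_succ_eval, mul_right_comm, ih, mul_comm,
        ← Real.Gamma_add_one (by positivity)]
      push_cast
      ring_nf
  rw [zero_add, one_div, ← Real.rpow_neg (by linarith)] at h
  refine (h.mul_left (Real.Gamma q)).congr_fun fun k => ?_
  have h1 := Ring.factorial_nsmul_multichoose_eq_ascPochhammer q k
  rw [Polynomial.ascPochhammer_smeval_eq_eval] at h1
  have h2 : Ring.choose (q + k - 1) k = Ring.multichoose q k := by
    rw [Ring.choose]; congr 1; ring
  rw [FormalMultilinearSeries.ofScalars_apply_eq, h2, ← hG, ← h1]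
  simp only [nsmul_eq_mul, smul_eq_mul]
  field_simp

/-- The Laplace-type transform `∫ y ^ p e ^ (-c y) F_m(y² / 4) dy`, when Legendre's duplication
formula applies to the moments. -/
lemma integral_rpow_mul_exp_mul_besselEntire {m c p q A : ℝ} (hm : -1 < m) (hc : 1 < c)
    (hp : -1 < p) (hq : 0 < q)
    (hA : ∀ k : ℕ, Real.Gamma (p + 2 * k + 1) = A * 4 ^ k * Real.Gamma (m + k + 1)
      * Real.Gamma (q + k)) :
    IntegrableOn (fun y => y ^ p * Real.exp (-(c * y)) * besselEntire m (y ^ 2 / 4)) (Ioi 0) ∧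
    ∫ y in Ioi (0 : ℝ), y ^ p * Real.exp (-(c * y)) * besselEntire m (y ^ 2 / 4)
      = A * (1 / c) ^ (p + 1) * (Real.Gamma q * (1 - 1 / c ^ 2) ^ (-q)) := by
  have hc0 : 0 < c := by linarith
  have hpk : ∀ k : ℕ, 0 < p + 2 * k + 1 := fun k => by
    have := k.cast_nonneg (α := ℝ); linarith
  set f : ℕ → ℝ → ℝ := fun k y => (4 ^ k * Real.Gamma (m + k + 1) * k.factorial)⁻¹
    * (y ^ (p + 2 * k + 1 - 1) * Real.exp (-(c * y))) with hf
  have hint : ∀ k, IntegrableOn (f k) (Ioi 0) := by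
    intro k
    refine Integrable.const_mul ?_ _
    have := integrableOn_rpow_mul_exp_neg_mul_rpow (p := 1) (s := p + 2 * k + 1 - 1) (b := c)
      (by linarith [hpk k]) one_pos hc0
    refine this.congr_fun (fun y _ => ?_) measurableSet_Ioi
    simp [neg_mul]
  -- The moment is a Gamma integral; `hA` cancels `4^k Γ(m+k+1)` and leaves a binomial series at `z
  -- = 1/c²`.
  have hval : ∀ k, ∫ y in Ioi 0, f k y
      = A * (1 / c) ^ (p + 1) * (Real.Gamma (q + k) / k.factorial * (1 / c ^ 2) ^ k) := by
    intro k
    have hG := gamma_add_nat_pos hm k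
    rw [integral_const_mul, Real.integral_rpow_mul_exp_neg_mul_Ioi (hpk k) hc0, hA,
      show p + 2 * k + 1 = (p + 1) + (2 * k : ℕ) by push_cast; ring,
      Real.rpow_add_natCast (by positivity), pow_mul]
    field_simp
  refine integrableOn_and_integral_eq_of_hasSum measurableSet_Ioi hint ?_ ?_ ?_ ?_
  · intro k y hy
    have hG := gamma_add_nat_pos hm k
    have := Real.rpow_pos_of_pos hy (p + 2 * k + 1 - 1)
    positivity
  · refine ContinuousOn.aestronglyMeasurable ?_ measurableSet_Ioi
    refine ((continuousOn_id.rpow_const fun y hy => Or.inl (ne_of_gt hy)).mul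
      (by fun_prop)).mul ?_
    exact ((continuous_besselEntire hm).comp (by fun_prop)).continuousOn
  · intro y hy
    rw [mem_Ioi] at hy
    refine ((summable_besselEntire hm (y ^ 2 / 4)).hasSum.mul_left
      (y ^ p * Real.exp (-(c * y)))).congr_fun fun k => ?_
    have hG := gamma_add_nat_pos hm k
    simp only [hf]
    rw [show p + 2 * k + 1 - 1 = p + (2 * k : ℕ) by push_cast; ring,
      Real.rpow_add_natCast hy.ne', pow_mul, div_pow]
    field_simp
  · simp only [hval]
    refine (hasSum_gamma_mul_pow hq (by positivity) ?_).mul_left _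
    rw [div_lt_one (by positivity)]
    nlinarith

lemma one_div_rpow_mul_one_sub_rpow {c q : ℝ} (hc : 1 < c) :
    (1 / c) ^ (2 * q) * (1 - 1 / c ^ 2) ^ (-q) = (c ^ 2 - 1) ^ (-q) := by
  have hc0 : 0 < c := by linarith
  have hd : 0 < c ^ 2 - 1 := by nlinarith
  rw [show 1 - 1 / c ^ 2 = (c ^ 2 - 1) / c ^ 2 by field_simp,
    Real.div_rpow hd.le (by positivity), Real.rpow_mul (by positivity), Real.rpow_two,
    one_div, Real.rpow_neg (by positivity : 0 ≤ c ^ 2), inv_pow, Real.inv_rpow (by positivity)]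
  have := Real.rpow_pos_of_pos (show 0 < c ^ 2 by positivity) q
  field_simp

lemma integral_unscaledPDF {m c : ℝ} (hm : -1 / 2 < m) (hc : 1 < c) :
    IntegrableOn (unscaledPDF m c) (Ioi 0) ∧
    ∫ y in Ioi (0 : ℝ), unscaledPDF m c y
      = 2 ^ (2 * m) / Real.sqrt Real.pi * Real.Gamma (m + 1 / 2)
        * (c ^ 2 - 1) ^ (-(m + 1 / 2)) := by
  have h := integral_rpow_mul_exp_mul_besselEntire (m := m) (c := c) (p := 2 * m)
    (q := m + 1 / 2) (A := 2 ^ (2 * m) / Real.sqrt Real.pi) (by linarith) hc (by linarith)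
    (by linarith) ?_
  · refine ⟨h.1, h.2.trans ?_⟩
    rw [← one_div_rpow_mul_one_sub_rpow hc, show 2 * (m + 1 / 2) = 2 * m + 1 by ring]
    ring
  · intro k
    -- Duplication at `m + 1/2 + k`; for the first moment the base point is `m + k + 1`.
    have hd := Real.Gamma_mul_Gamma_add_half (m + 1 / 2 + k)
    rw [show m + 1 / 2 + k + 1 / 2 = m + k + 1 by ring,
      show 2 * (m + 1 / 2 + k) = 2 * m + 2 * k + 1 by ring,
      show 1 - (2 * m + 2 * (k : ℝ) + 1) = -(2 * m + (2 * k : ℕ)) by push_cast; ring,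
      Real.rpow_neg (by norm_num), Real.rpow_add_natCast (by norm_num), pow_mul] at hd
    have h2 := Real.rpow_pos_of_pos (show (0 : ℝ) < 2 by norm_num) (2 * m)
    have h3 : 0 < Real.sqrt Real.pi := Real.sqrt_pos.2 Real.pi_pos
    have : Real.Gamma (2 * m + 2 * k + 1) = 2 ^ (2 * m) / Real.sqrt Real.pi * (2 ^ 2) ^ k
        * (Real.Gamma (m + 1 / 2 + k) * Real.Gamma (m + k + 1)) := by
      rw [hd]; field_simp
    rw [this]
    norm_num
    ring

lemma integral_id_mul_unscaledPDF {m c : ℝ} (hm : -1 / 2 < m) (hc : 1 < c) :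
    IntegrableOn (fun y => y * unscaledPDF m c y) (Ioi 0) ∧
    ∫ y in Ioi (0 : ℝ), y * unscaledPDF m c y
      = 2 ^ (2 * m + 1) / Real.sqrt Real.pi * c * Real.Gamma (m + 3 / 2)
        * (c ^ 2 - 1) ^ (-(m + 3 / 2)) := by
  have hc0 : 0 < c := by linarith
  have h := integral_rpow_mul_exp_mul_besselEntire (m := m) (c := c) (p := 2 * m + 1)
    (q := m + 3 / 2) (A := 2 ^ (2 * m + 1) / Real.sqrt Real.pi) (by linarith) hc (by linarith)
    (by linarith) ?_
  · have e : EqOn (fun y => y ^ (2 * m + 1) * Real.exp (-(c * y)) * besselEntire m (y ^ 2 / 4))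
        (fun y => y * unscaledPDF m c y) (Ioi 0) := by
      intro y hy
      simp only [unscaledPDF]
      rw [Real.rpow_add_one (ne_of_gt hy)]
      ring
    refine ⟨h.1.congr_fun e measurableSet_Ioi, ?_⟩
    rw [← setIntegral_congr_fun measurableSet_Ioi e, h.2, ← one_div_rpow_mul_one_sub_rpow hc,
      show 2 * (m + 3 / 2) = 2 * m + 1 + 1 + 1 by ring,
      Real.rpow_add_one (show 1 / c ≠ 0 by positivity) (2 * m + 1 + 1)]
    field_simp
  · intro k
    have hd := Real.Gamma_mul_Gamma_add_half (m + k + 1)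
    rw [show m + k + 1 + 1 / 2 = m + 3 / 2 + k by ring,
      show 2 * (m + k + 1) = 2 * m + 1 + 2 * k + 1 by ring,
      show 1 - (2 * m + 1 + 2 * (k : ℝ) + 1) = -(2 * m + 1 + (2 * k : ℕ)) by push_cast; ring,
      Real.rpow_neg (by norm_num), Real.rpow_add_natCast (by norm_num), pow_mul] at hd
    have h2 := Real.rpow_pos_of_pos (show (0 : ℝ) < 2 by norm_num) (2 * m + 1)
    have h3 : 0 < Real.sqrt Real.pi := Real.sqrt_pos.2 Real.pi_pos
    have : Real.Gamma (2 * m + 1 + 2 * k + 1) = 2 ^ (2 * m + 1) / Real.sqrt Real.pi * (2 ^ 2) ^ k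
        * (Real.Gamma (m + k + 1) * Real.Gamma (m + 3 / 2 + k)) := by
      rw [hd]; field_simp
    rw [this]
    norm_num
    ring

/-! ### Modes of distributions with a density -/

section Density

variable {p : ℝ → ℝ}

lemma real_Iic_withDensity (hp0 : ∀ x, 0 ≤ p x) (hp : Integrable p) (x : ℝ) :
    (volume.withDensity fun x => ENNReal.ofReal (p x)).real (Iic x) = ∫ t in Iic x, p t := by
  rw [Measure.real, withDensity_apply _ measurableSet_Iic,
    integral_eq_lintegral_of_nonneg_ae (ae_of_all _ hp0) hp.aestronglyMeasurable.restrict]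

lemma hasDerivAt_real_Iic_withDensity (hp0 : ∀ x, 0 ≤ p x) (hp : Integrable p) {x : ℝ}
    (hx : ContinuousAt p x) :
    HasDerivAt (fun x => (volume.withDensity fun x => ENNReal.ofReal (p x)).real (Iic x))
      (p x) x := by
  have h : (fun x => (volume.withDensity fun x => ENNReal.ofReal (p x)).real (Iic x))
      = fun y => (∫ t in Iic x, p t) + ∫ t in x..y, p t := by
    ext y
    rw [real_Iic_withDensity hp0 hp,
      ← intervalIntegral.integral_Iic_sub_Iic hp.integrableOn hp.integrableOn]
    ring
  rw [h]
  exact (intervalIntegral.integral_hasDerivAt_right hp.intervalIntegrable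
    hp.aestronglyMeasurable.stronglyMeasurableAtFilter hx).const_add _

lemma convexOn_real_Iic_withDensity (hp0 : ∀ x, 0 ≤ p x) (hp : Integrable p) {D : Set ℝ}
    (hD : Convex ℝ D) (hDo : IsOpen D) (hc : ∀ x ∈ D, ContinuousAt p x) (hmono : MonotoneOn p D) :
    ConvexOn ℝ D fun x => (volume.withDensity fun x => ENNReal.ofReal (p x)).real (Iic x) := by
  have hd := fun x hx => hasDerivAt_real_Iic_withDensity hp0 hp (hc x hx)
  refine MonotoneOn.convexOn_of_deriv hD
    (fun x hx => (hd x hx).continuousAt.continuousWithinAt) ?_ ?_ <;> rw [hDo.interior_eq]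
  · exact fun x hx => (hd x hx).differentiableAt.differentiableWithinAt
  · exact hmono.congr fun x hx => (hd x hx).deriv.symm

lemma concaveOn_real_Iic_withDensity (hp0 : ∀ x, 0 ≤ p x) (hp : Integrable p) {D : Set ℝ}
    (hD : Convex ℝ D) (hDo : IsOpen D) (hc : ∀ x ∈ D, ContinuousAt p x) (hanti : AntitoneOn p D) :
    ConcaveOn ℝ D fun x => (volume.withDensity fun x => ENNReal.ofReal (p x)).real (Iic x) := by
  have hd := fun x hx => hasDerivAt_real_Iic_withDensity hp0 hp (hc x hx)
  refine AntitoneOn.concaveOn_of_deriv hD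
    (fun x hx => (hd x hx).continuousAt.continuousWithinAt) ?_ ?_ <;> rw [hDo.interior_eq]
  · exact fun x hx => (hd x hx).differentiableAt.differentiableWithinAt
  · exact hanti.congr fun x hx => (hd x hx).deriv.symm

/-- The slope of the chord of the convex distribution function separates its derivatives at the two
points. This converse direction yields uniqueness of the mode. -/
lemma IsMode.density_le_of_lt {a x y : ℝ}
    (h : IsMode (volume.withDensity fun x => ENNReal.ofReal (p x)) a)
    (hp0 : ∀ x, 0 ≤ p x) (hp : Integrable p) (hx : ContinuousAt p x) (hy : ContinuousAt p y)
    (hxy : x < y) (hya : y < a) : p x ≤ p y :=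
  (h.1.le_slope_of_hasDerivAt (mem_Iio.2 (hxy.trans hya)) (mem_Iio.2 hya) hxy
    (hasDerivAt_real_Iic_withDensity hp0 hp hx)).trans
  (h.1.slope_le_of_hasDerivAt (mem_Iio.2 (hxy.trans hya)) (mem_Iio.2 hya) hxy
    (hasDerivAt_real_Iic_withDensity hp0 hp hy))

lemma IsMode.density_ge_of_lt {a x y : ℝ}
    (h : IsMode (volume.withDensity fun x => ENNReal.ofReal (p x)) a)
    (hp0 : ∀ x, 0 ≤ p x) (hp : Integrable p) (hx : ContinuousAt p x) (hy : ContinuousAt p y)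
    (hax : a < x) (hxy : x < y) : p y ≤ p x :=
  (h.2.le_slope_of_hasDerivAt (mem_Ioi.2 hax) (mem_Ioi.2 (hax.trans hxy)) hxy
    (hasDerivAt_real_Iic_withDensity hp0 hp hy)).trans
  (h.2.slope_le_of_hasDerivAt (mem_Ioi.2 hax) (mem_Ioi.2 (hax.trans hxy)) hxy
    (hasDerivAt_real_Iic_withDensity hp0 hp hx))

end Density

/-! ### Scaling, normalisation and mean of the McKay distribution -/

/-- The normalising constant of the McKay Type I distribution relative to `unscaledPDF`. -/
noncomputable def normalizer (m c : ℝ) : ℝ :=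
  Real.sqrt Real.pi * (c ^ 2 - 1) ^ (m + 1 / 2) / (2 ^ (2 * m) * Real.Gamma (m + 1 / 2))

lemma normalizer_pos {m c : ℝ} (hm : -1 / 2 < m) (hc : 1 < c) : 0 < normalizer m c := by
  have hd : 0 < c ^ 2 - 1 := by nlinarith
  have hG : 0 < Real.Gamma (m + 1 / 2) := Real.Gamma_pos_of_pos (by linarith)
  have := Real.sqrt_pos.2 Real.pi_pos
  unfold normalizer
  positivity

lemma mcKayPDF_of_pos {m b c x : ℝ} (hb : 0 < b) (hx : 0 < x) :
    mcKayPDF m b c x = normalizer m c / b * unscaledPDF m c (x / b) := by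
  obtain ⟨y, rfl⟩ : ∃ y, x = b * y := ⟨x / b, by field_simp⟩
  have hy : 0 < y := (mul_pos_iff_of_pos_left hb).1 hx
  rw [mcKayPDF, if_pos hx, mul_div_cancel_left₀ _ hb.ne', besselI_eq hy, unscaledPDF, normalizer,
    show c * (b * y) / b = c * y by field_simp, Real.mul_rpow hb.le hy.le,
    Real.rpow_add_one hb.ne', Real.div_rpow hy.le (by norm_num), two_mul, Real.rpow_add hy,
    Real.rpow_add (by norm_num : (0 : ℝ) < 2)]
  have h1 := Real.rpow_pos_of_pos hb m
  have h2 := Real.rpow_pos_of_pos (show (0 : ℝ) < 2 by norm_num) m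
  field_simp

lemma mcKayPDF_of_nonpos {m b c x : ℝ} (hx : x ≤ 0) : mcKayPDF m b c x = 0 :=
  if_neg hx.not_gt

lemma unscaledPDF_pos {m c y : ℝ} (hm : -1 < m) (hy : 0 < y) : 0 < unscaledPDF m c y := by
  have h1 := Real.rpow_pos_of_pos hy (2 * m)
  have h2 := besselEntire_pos hm (show 0 ≤ y ^ 2 / 4 by positivity)
  unfold unscaledPDF
  positivity

lemma mcKayPDF_pos {m b c x : ℝ} (hm : -1 / 2 < m) (hb : 0 < b) (hc : 1 < c) (hx : 0 < x) :
    0 < mcKayPDF m b c x := by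
  rw [mcKayPDF_of_pos hb hx]
  have := normalizer_pos hm hc
  have := unscaledPDF_pos (c := c) (show -1 < m by linarith) (show 0 < x / b by positivity)
  positivity

lemma mcKayPDF_nonneg {m b c : ℝ} (hm : -1 / 2 < m) (hb : 0 < b) (hc : 1 < c) (x : ℝ) :
    0 ≤ mcKayPDF m b c x := by
  rcases le_or_gt x 0 with hx | hx
  · exact (mcKayPDF_of_nonpos hx).ge
  · exact (mcKayPDF_pos hm hb hc hx).le

lemma mcKayPDF_eq_indicator {m b c : ℝ} (hb : 0 < b) :
    mcKayPDF m b c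
      = (Ioi 0).indicator fun x => normalizer m c / b * unscaledPDF m c (b⁻¹ * x) := by
  ext x
  by_cases hx : 0 < x
  · rw [indicator_of_mem (mem_Ioi.2 hx), mcKayPDF_of_pos hb hx, inv_mul_eq_div]
  · rw [indicator_of_notMem (by simpa using hx), mcKayPDF_of_nonpos (not_lt.1 hx)]

lemma integrable_mcKayPDF {m b c : ℝ} (hm : -1 / 2 < m) (hb : 0 < b) (hc : 1 < c) :
    Integrable (mcKayPDF m b c) := by
  rw [mcKayPDF_eq_indicator hb, integrable_indicator_iff measurableSet_Ioi]
  refine Integrable.const_mul ?_ _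
  have := (integrableOn_Ioi_comp_mul_left_iff (unscaledPDF m c) 0 (inv_pos.2 hb)).2
    (by simpa using (integral_unscaledPDF hm hc).1)
  exact this

lemma integral_mcKayPDF {m b c : ℝ} (hm : -1 / 2 < m) (hb : 0 < b) (hc : 1 < c) :
    ∫ x, mcKayPDF m b c x = 1 := by
  have hd : 0 < c ^ 2 - 1 := by nlinarith
  rw [mcKayPDF_eq_indicator hb, integral_indicator measurableSet_Ioi, integral_const_mul,
    integral_comp_mul_left_Ioi (unscaledPDF m c) 0 (inv_pos.2 hb), mul_zero,
    (integral_unscaledPDF hm hc).2, normalizer, Real.rpow_neg hd.le, smul_eq_mul, inv_inv]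
  have hG : 0 < Real.Gamma (m + 1 / 2) := Real.Gamma_pos_of_pos (by linarith)
  have h1 := Real.sqrt_pos.2 Real.pi_pos
  have h2 := Real.rpow_pos_of_pos hd (m + 1 / 2)
  have h3 := Real.rpow_pos_of_pos (show (0 : ℝ) < 2 by norm_num) (2 * m)
  generalize Real.Gamma (m + 1 / 2) = G at *
  generalize (c ^ 2 - 1) ^ (m + 1 / 2) = D at *
  generalize (2 : ℝ) ^ (2 * m) = T at *
  generalize Real.sqrt Real.pi = s at *
  field_simp

lemma id_mul_mcKayPDF_eq_indicator {m b c : ℝ} (hb : 0 < b) :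
    (fun x => x * mcKayPDF m b c x) = (Ioi 0).indicator
      fun x => normalizer m c * ((b⁻¹ * x) * unscaledPDF m c (b⁻¹ * x)) := by
  ext x
  rw [mcKayPDF_eq_indicator hb]
  by_cases hx : 0 < x
  · rw [indicator_of_mem (mem_Ioi.2 hx), indicator_of_mem (mem_Ioi.2 hx)]
    field_simp
  · rw [indicator_of_notMem (by simpa using hx), indicator_of_notMem (by simpa using hx), mul_zero]

lemma integrable_id_mul_mcKayPDF {m b c : ℝ} (hm : -1 / 2 < m) (hb : 0 < b) (hc : 1 < c) :
    Integrable fun x => x * mcKayPDF m b c x := by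
  rw [id_mul_mcKayPDF_eq_indicator hb, integrable_indicator_iff measurableSet_Ioi]
  refine Integrable.const_mul ?_ _
  have := (integrableOn_Ioi_comp_mul_left_iff (fun y => y * unscaledPDF m c y) 0
    (inv_pos.2 hb)).2 (by simpa using (integral_id_mul_unscaledPDF hm hc).1)
  exact this

/-- The factor `2m + 1` is `2(m + 1/2)`, from `Γ(m+3/2) = (m+1/2) Γ(m+1/2)`. -/
lemma integral_id_mul_mcKayPDF {m b c : ℝ} (hm : -1 / 2 < m) (hb : 0 < b) (hc : 1 < c) :
    ∫ x, x * mcKayPDF m b c x = (2 * m + 1) * (b * c / (c ^ 2 - 1)) := by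
  have hd : 0 < c ^ 2 - 1 := by nlinarith
  have hc0 : 0 < c := by linarith
  rw [id_mul_mcKayPDF_eq_indicator hb, integral_indicator measurableSet_Ioi, integral_const_mul,
    integral_comp_mul_left_Ioi (fun y => y * unscaledPDF m c y) 0 (inv_pos.2 hb), mul_zero,
    (integral_id_mul_unscaledPDF hm hc).2, normalizer, Real.rpow_neg hd.le, smul_eq_mul, inv_inv,
    show m + 3 / 2 = m + 1 / 2 + 1 by ring, Real.Gamma_add_one (by linarith),
    Real.rpow_add_one hd.ne', Real.rpow_add_one (by norm_num)]
  have hG : 0 < Real.Gamma (m + 1 / 2) := Real.Gamma_pos_of_pos (by linarith)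
  have h1 := Real.sqrt_pos.2 Real.pi_pos
  have h2 := Real.rpow_pos_of_pos hd (m + 1 / 2)
  have h3 := Real.rpow_pos_of_pos (show (0 : ℝ) < 2 by norm_num) (2 * m)
  generalize Real.Gamma (m + 1 / 2) = G at *
  generalize (c ^ 2 - 1) ^ (m + 1 / 2) = D at *
  generalize (2 : ℝ) ^ (2 * m) = T at *
  generalize Real.sqrt Real.pi = s at *
  field_simp

lemma isProbabilityMeasure_mcKayTypeI {m b c : ℝ} (hm : -1 / 2 < m) (hb : 0 < b) (hc : 1 < c) :
    IsProbabilityMeasure (mcKayTypeI m b c) := by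
  refine ⟨?_⟩
  rw [mcKayTypeI, withDensity_apply _ MeasurableSet.univ, Measure.restrict_univ,
    ← ofReal_integral_eq_lintegral_ofReal (integrable_mcKayPDF hm hb hc)
      (ae_of_all _ (mcKayPDF_nonneg hm hb hc)), integral_mcKayPDF hm hb hc, ENNReal.ofReal_one]

lemma integrable_id_mcKayTypeI {m b c : ℝ} (hm : -1 / 2 < m) (hb : 0 < b) (hc : 1 < c) :
    Integrable (fun x : ℝ => x) (mcKayTypeI m b c) := by
  rw [mcKayTypeI, integrable_withDensity_iff_integrable_smul₀'
    (integrable_mcKayPDF hm hb hc).aestronglyMeasurable.aemeasurable.ennreal_ofReal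
    (ae_of_all _ fun _ => ENNReal.ofReal_lt_top)]
  refine (integrable_id_mul_mcKayPDF hm hb hc).congr (ae_of_all _ fun x => ?_)
  simp only [ENNReal.toReal_ofReal (mcKayPDF_nonneg hm hb hc x), smul_eq_mul, mul_comm]

lemma integral_id_mcKayTypeI {m b c : ℝ} (hm : -1 / 2 < m) (hb : 0 < b) (hc : 1 < c) :
    ∫ x, x ∂(mcKayTypeI m b c) = (2 * m + 1) * (b * c / (c ^ 2 - 1)) := by
  rw [mcKayTypeI, integral_withDensity_eq_integral_toReal_smul₀
    (integrable_mcKayPDF hm hb hc).aestronglyMeasurable.aemeasurable.ennreal_ofReal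
    (ae_of_all _ fun _ => ENNReal.ofReal_lt_top), ← integral_id_mul_mcKayPDF hm hb hc]
  refine integral_congr_ae (ae_of_all _ fun x => ?_)
  simp only [ENNReal.toReal_ofReal (mcKayPDF_nonneg hm hb hc x), smul_eq_mul, mul_comm]

lemma continuousAt_mcKayPDF {m b c x : ℝ} (hm : -1 < m) (hb : 0 < b) (hx : x ≠ 0) :
    ContinuousAt (mcKayPDF m b c) x := by
  rcases hx.lt_or_gt with hx | hx
  · refine (continuousAt_const (y := (0 : ℝ))).congr ?_
    filter_upwards [Iio_mem_nhds hx] with y hy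
    exact (mcKayPDF_of_nonpos (le_of_lt hy)).symm
  · have h : ContinuousAt (fun x => normalizer m c / b * unscaledPDF m c (x / b)) x :=
      continuousAt_const.mul (ContinuousAt.comp (f := fun x => x / b)
        (hasDerivAt_unscaledPDF hm (div_pos hx hb)).continuousAt (by fun_prop))
    refine h.congr ?_
    filter_upwards [Ioi_mem_nhds hx] with y hy
    exact (mcKayPDF_of_pos hb hy).symm

/-- For `m > 0` the factor `y^(2m)` vanishes at 0. Continuity there is needed because `(-∞, M)`
contains 0 when the mode is positive. -/
lemma continuous_mcKayPDF {m b c : ℝ} (hm : 0 < m) (hb : 0 < b) :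
    Continuous (mcKayPDF m b c) := by
  have hψ : Continuous (unscaledPDF m c) :=
    ((Real.continuous_rpow_const (by linarith)).mul (by fun_prop)).mul
      ((continuous_besselEntire (by linarith)).comp (by fun_prop))
  have h : mcKayPDF m b c
      = fun x => normalizer m c / b * unscaledPDF m c (max x 0 / b) := by
    ext x
    rcases le_or_gt x 0 with hx | hx
    · rw [mcKayPDF_of_nonpos hx, max_eq_right hx, zero_div, unscaledPDF,
        Real.zero_rpow (by linarith)]
      ring
    · rw [mcKayPDF_of_pos hb hx, max_eq_left hx.le]
  rw [h]
  exact continuous_const.mul (hψ.comp (by fun_prop))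

/-! ### Existence and uniqueness of the mode -/

/-- The density is zero on the left and strictly decreasing on the right. A negative mode would
bound a positive density value by 0; a positive one would make the density nondecreasing on an
interval where it strictly decreases. -/
lemma isMode_mcKayTypeI_iff_of_nonpos {m b c : ℝ} (hm : -1 / 2 < m) (hm0 : m ≤ 0) (hb : 0 < b)
    (hc : 1 < c) (M : ℝ) : IsMode (mcKayTypeI m b c) M ↔ M = 0 := by
  have hm1 : -1 < m := by linarith
  have hp0 := mcKayPDF_nonneg hm hb hc
  have hp := integrable_mcKayPDF hm hb hc
  have hanti : StrictAntiOn (mcKayPDF m b c) (Ioi 0) := by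
    intro x hx y hy hxy
    rw [mcKayPDF_of_pos hb hx, mcKayPDF_of_pos hb hy]
    refine mul_lt_mul_of_pos_left ?_ (div_pos (normalizer_pos hm hc) hb)
    exact strictAntiOn_unscaledPDF_Ioi hm1 (fun y hy => pdfSlope_neg hm1 hm0 hc hy)
      (div_pos hx hb) (div_pos hy hb) (div_lt_div_of_pos_right hxy hb)
  constructor
  · intro h
    rcases lt_trichotomy M 0 with hM | hM | hM
    · have := h.density_ge_of_lt hp0 hp (x := M / 2) (y := 1)
        (continuousAt_mcKayPDF hm1 hb (by linarith)) (continuousAt_mcKayPDF hm1 hb one_ne_zero)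
        (by linarith) (by linarith)
      rw [mcKayPDF_of_nonpos (show M / 2 ≤ 0 by linarith)] at this
      exact absurd this (mcKayPDF_pos hm hb hc one_pos).not_ge
    · exact hM
    · have := h.density_le_of_lt hp0 hp (x := M / 3) (y := M / 2)
        (continuousAt_mcKayPDF hm1 hb (by linarith)) (continuousAt_mcKayPDF hm1 hb (by linarith))
        (by linarith) (by linarith)
      exact absurd this (hanti (mem_Ioi.2 (by linarith)) (mem_Ioi.2 (by linarith))
        (show M / 3 < M / 2 by linarith)).not_ge
  · rintro rfl
    refine ⟨convexOn_real_Iic_withDensity hp0 hp (convex_Iio 0) isOpen_Iio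
      (fun x hx => continuousAt_mcKayPDF hm1 hb (ne_of_lt hx)) ?_,
      concaveOn_real_Iic_withDensity hp0 hp (convex_Ioi 0) isOpen_Ioi
      (fun x hx => continuousAt_mcKayPDF hm1 hb (ne_of_gt hx)) hanti.antitoneOn⟩
    intro x hx y hy _
    rw [mcKayPDF_of_nonpos (le_of_lt hx), mcKayPDF_of_nonpos (le_of_lt hy)]

/-- For `m > 0`, the mode is `b y₀` with `y₀` the zero of `pdfSlope m c`. -/
lemma exists_mode_mcKayTypeI {m b c : ℝ} (hm : 0 < m) (hb : 0 < b) (hc : 1 < c) :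
    ∃ y₀, 0 < y₀ ∧ (2 * m - 1) * c < (c ^ 2 - 1) * y₀ ∧ pdfSlope m c y₀ = 0 ∧
      (∀ M, IsMode (mcKayTypeI m b c) M ↔ M = b * y₀) ∧
      ∀ x, 0 < x → x ≠ b * y₀ → mcKayPDF m b c x < mcKayPDF m b c (b * y₀) := by
  have hm1 : -1 < m := by linarith
  have hm2 : -1 / 2 < m := by linarith
  obtain ⟨y₀, hy0, hlow, hzero, hpos, hneg⟩ := exists_pdfSlope_sign_change hm hc
  have hK := div_pos (normalizer_pos hm2 hc) hb
  have hby : 0 < b * y₀ := mul_pos hb hy0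
  have hmono : StrictMonoOn (mcKayPDF m b c) (Ioc 0 (b * y₀)) := by
    intro x hx y hy hxy
    rw [mcKayPDF_of_pos hb hx.1, mcKayPDF_of_pos hb hy.1]
    refine mul_lt_mul_of_pos_left ?_ hK
    exact strictMonoOn_unscaledPDF hm1 hpos ⟨div_pos hx.1 hb, (div_le_iff₀' hb).2 hx.2⟩
      ⟨div_pos hy.1 hb, (div_le_iff₀' hb).2 hy.2⟩ (div_lt_div_of_pos_right hxy hb)
  have hanti : StrictAntiOn (mcKayPDF m b c) (Ici (b * y₀)) := by
    intro x hx y hy hxy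
    rw [mem_Ici] at hx hy
    rw [mcKayPDF_of_pos hb (hby.trans_le hx), mcKayPDF_of_pos hb (hby.trans_le hy)]
    refine mul_lt_mul_of_pos_left ?_ hK
    exact strictAntiOn_unscaledPDF hm1 hy0 hneg ((le_div_iff₀' hb).2 hx)
      ((le_div_iff₀' hb).2 hy) (div_lt_div_of_pos_right hxy hb)
  have hp0 := mcKayPDF_nonneg hm2 hb hc
  have hp := integrable_mcKayPDF hm2 hb hc
  have hcont := fun x => (continuous_mcKayPDF (c := c) hm hb).continuousAt (x := x)
  refine ⟨y₀, hy0, hlow, hzero, fun M => ⟨fun h => ?_, ?_⟩, fun x hx hne => ?_⟩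
  · rcases lt_trichotomy M (b * y₀) with hM | hM | hM
    -- The candidate `M` may be negative; the maximum with 0 keeps both test points where the
    -- density strictly increases.
    · obtain ⟨x, hx1, hx2⟩ := exists_between (max_lt hM hby)
      obtain ⟨y, hy1, hy2⟩ := exists_between hx2
      rw [max_lt_iff] at hx1
      have := h.density_ge_of_lt hp0 hp (hcont x) (hcont y) hx1.1 hy1
      exact absurd this (hmono ⟨hx1.2, hx2.le⟩ ⟨hx1.2.trans hy1, hy2.le⟩ hy1).not_ge
    · exact hM
    · obtain ⟨x, hx1, hx2⟩ := exists_between hM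
      obtain ⟨y, hy1, hy2⟩ := exists_between hx2
      have := h.density_le_of_lt hp0 hp (hcont x) (hcont y) hy1 hy2
      exact absurd this (hanti hx1.le (hx1.trans hy1).le hy1).not_ge
  · rintro rfl
    refine ⟨convexOn_real_Iic_withDensity hp0 hp (convex_Iio _) isOpen_Iio
      (fun x _ => hcont x) ?_,
      concaveOn_real_Iic_withDensity hp0 hp (convex_Ioi _) isOpen_Ioi
      (fun x _ => hcont x) (hanti.antitoneOn.mono Ioi_subset_Ici_self)⟩
    intro x hx y hy hxy
    rcases le_or_gt x 0 with hx0 | hx0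
    · rw [mcKayPDF_of_nonpos hx0]
      exact hp0 y
    · exact hmono.monotoneOn ⟨hx0, le_of_lt hx⟩ ⟨hx0.trans_le hxy, le_of_lt hy⟩ hxy
  · rcases hne.lt_or_gt with h | h
    · exact hmono ⟨hx, h.le⟩ ⟨hby, le_rfl⟩ h
    · exact hanti (mem_Ici.2 le_rfl) (mem_Ici.2 h.le) h

/-! ### Bounds for the mode -/

lemma sqrt_mode_bound_lt {m c : ℝ} (hm : 0 < m) (hc : 1 < c) :
    Real.sqrt ((m + 1 / 2) ^ 2 - 2 * m / c ^ 2) < m + 1 / 2 := by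
  rw [Real.sqrt_lt' (by linarith)]
  have : 0 < 2 * m / c ^ 2 := by positivity
  linarith

/-- The bounds for the mode when `m > 0`. -/
lemma mode_bounds {m b c M : ℝ} (hm : 0 < m) (hb : 0 < b) (hc : 1 < c)
    (hM : IsMode (mcKayTypeI m b c) M) :
    0 < M ∧ (2 * m - 1) * (b * c / (c ^ 2 - 1)) < M ∧
      M < b * c / (c ^ 2 - 1) * (m - 1 / 2 + Real.sqrt ((m + 1 / 2) ^ 2 - 2 * m / c ^ 2)) ∧
      b * c / (c ^ 2 - 1)
        * (m - 1 + Real.sqrt ((m - 1) ^ 2 + 4 * (c ^ 2 - 1) * m / c ^ 2)) < M := by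
  have hd : 0 < c ^ 2 - 1 := by nlinarith
  obtain ⟨y₀, hy0, hlow, hzero, hiff, -⟩ := exists_mode_mcKayTypeI hm hb hc
  obtain rfl := (hiff M).1 hM
  have h1 : (2 * m - 1) * c / (c ^ 2 - 1) < y₀ := (div_lt_iff₀' hd).2 hlow
  have h2 := critical_point_lt (by linarith) hc hy0 hzero
  have h3 := lt_critical_point hm hc hy0 hzero
  refine ⟨mul_pos hb hy0, ?_, ?_, ?_⟩
  · refine lt_of_eq_of_lt ?_ (mul_lt_mul_of_pos_left h1 hb)
    ring
  · refine (mul_lt_mul_of_pos_left h2 hb).trans_eq ?_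
    ring
  · refine lt_of_eq_of_lt ?_ (mul_lt_mul_of_pos_left h3 hb)
    ring

lemma exists_isMode_mcKayTypeI {m b c : ℝ} (hm : 0 < m) (hb : 0 < b) (hc : 1 < c) :
    ∃ M, IsMode (mcKayTypeI m b c) M :=
  let ⟨y₀, _, _, _, h, _⟩ := exists_mode_mcKayTypeI hm hb hc
  ⟨b * y₀, (h _).2 rfl⟩

/-- As `c → 1`, the upper bound for the mode with `m = 1` tends to the lower one. -/
lemma le_one_of_forall_le_mode_bound {a : ℝ}
    (h : ∀ c : ℝ, 1 < c →
      a ≤ 1 - 1 / 2 + Real.sqrt ((1 + 1 / 2) ^ 2 - 2 * 1 / c ^ 2)) : a ≤ 1 := by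
  have hc : ContinuousAt
      (fun c : ℝ => 1 - 1 / 2 + Real.sqrt ((1 + 1 / 2) ^ 2 - 2 * 1 / c ^ 2)) 1 := by
    refine continuousAt_const.add (Real.continuous_sqrt.continuousAt.comp ?_)
    exact continuousAt_const.sub (continuousAt_const.div (by fun_prop) (by norm_num))
  have hlim := hc.tendsto.mono_left (nhdsWithin_le_nhds (s := Ioi 1))
  have hv : 1 - 1 / 2 + Real.sqrt ((1 + 1 / 2) ^ 2 - 2 * 1 / (1 : ℝ) ^ 2) = 1 := by
    rw [show (1 + 1 / 2) ^ 2 - 2 * 1 / (1 : ℝ) ^ 2 = (1 / 2) ^ 2 by norm_num,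
      Real.sqrt_sq (by norm_num)]
    norm_num
  rw [hv] at hlim
  exact ge_of_tendsto hlim (by filter_upwards [self_mem_nhdsWithin] with c hc using h c hc)

end McKay

/-! ### Assembly and sharpness of the constants -/

theorem theorem2 :
    -- the distribution is a unimodal probability distribution, and its mode is unique
    (∀ m b c : ℝ, -1 / 2 < m → 0 < b → 1 < c →
      IsProbabilityMeasure (McKay.mcKayTypeI m b c) ∧
      McKay.IsUnimodal (McKay.mcKayTypeI m b c) ∧
      ∃! M : ℝ, McKay.IsMode (McKay.mcKayTypeI m b c) M) ∧
    -- the mode for `-1/2 < m ≤ 0`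
    (∀ m b c M : ℝ, -1 / 2 < m → m ≤ 0 → 0 < b → 1 < c →
      McKay.IsMode (McKay.mcKayTypeI m b c) M → M = 0) ∧
    -- the bounds for `m > 0`
    (∀ m b c M : ℝ, 0 < m → 0 < b → 1 < c →
      McKay.IsMode (McKay.mcKayTypeI m b c) M →
      -- the mode is the strict maximum point of the density on `(0, ∞)`
      (0 < M ∧ ∀ x : ℝ, 0 < x → x ≠ M → McKay.mcKayPDF m b c x < McKay.mcKayPDF m b c M) ∧
      -- the two-sided bound for the mode
      ((2 * m - 1) * b * c / (c ^ 2 - 1) < M ∧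
        M < b * c / (c ^ 2 - 1)
            * (m - 1 / 2 + Real.sqrt ((m + 1 / 2) ^ 2 - 2 * m / c ^ 2)) ∧
        b * c / (c ^ 2 - 1)
            * (m - 1 / 2 + Real.sqrt ((m + 1 / 2) ^ 2 - 2 * m / c ^ 2))
          < 2 * m * b * c / (c ^ 2 - 1)) ∧
      -- the two-sided bound for the difference of the mean and the mode
      (Integrable (fun x : ℝ => x) (McKay.mcKayTypeI m b c) ∧
        b * c / (c ^ 2 - 1)
          < b * c / (c ^ 2 - 1)
            * (3 / 2 + m - Real.sqrt ((m + 1 / 2) ^ 2 - 2 * m / c ^ 2)) ∧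
        b * c / (c ^ 2 - 1)
            * (3 / 2 + m - Real.sqrt ((m + 1 / 2) ^ 2 - 2 * m / c ^ 2))
          < (∫ x, x ∂(McKay.mcKayTypeI m b c)) - M ∧
        (∫ x, x ∂(McKay.mcKayTypeI m b c)) - M < 2 * b * c / (c ^ 2 - 1)) ∧
      -- the alternative lower bound for the mode
      b * c / (c ^ 2 - 1)
          * (m - 1 + Real.sqrt ((m - 1) ^ 2 + 4 * (c ^ 2 - 1) * m / c ^ 2)) < M) ∧
    -- best possible lower and upper bounds for the mode of the form `(2 m - α) b c / (c² - 1)`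
    IsLeast {α : ℝ | ∀ m b c M : ℝ, 0 < m → 0 < b → 1 < c →
      McKay.IsMode (McKay.mcKayTypeI m b c) M →
        (2 * m - α) * b * c / (c ^ 2 - 1) ≤ M} 1 ∧
    IsGreatest {α : ℝ | ∀ m b c M : ℝ, 0 < m → 0 < b → 1 < c →
      McKay.IsMode (McKay.mcKayTypeI m b c) M →
        M ≤ (2 * m - α) * b * c / (c ^ 2 - 1)} 0 ∧
    -- best possible lower and upper bounds for mean minus mode of the form `β b c / (c² - 1)`
    IsGreatest {β : ℝ | ∀ m b c M : ℝ, 0 < m → 0 < b → 1 < c →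
      McKay.IsMode (McKay.mcKayTypeI m b c) M →
        β * b * c / (c ^ 2 - 1) ≤ (∫ x, x ∂(McKay.mcKayTypeI m b c)) - M} 1 ∧
    IsLeast {β : ℝ | ∀ m b c M : ℝ, 0 < m → 0 < b → 1 < c →
      McKay.IsMode (McKay.mcKayTypeI m b c) M →
        (∫ x, x ∂(McKay.mcKayTypeI m b c)) - M ≤ β * b * c / (c ^ 2 - 1)} 2 := by
  open McKay in
  refine ⟨fun m b c hm hb hc => ?_, fun m b c M hm hm0 hb hc hM => ?_,
    fun m b c M hm hb hc hM => ?_, ⟨?_, ?_⟩, ⟨?_, ?_⟩, ⟨?_, ?_⟩, ⟨?_, ?_⟩⟩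
  · refine ⟨isProbabilityMeasure_mcKayTypeI hm hb hc, ?_⟩
    have : ∃ a, ∀ M, IsMode (mcKayTypeI m b c) M ↔ M = a := by
      rcases le_or_gt m 0 with hm0 | hm0
      · exact ⟨0, isMode_mcKayTypeI_iff_of_nonpos hm hm0 hb hc⟩
      · obtain ⟨y₀, -, -, -, h, -⟩ := exists_mode_mcKayTypeI hm0 hb hc
        exact ⟨b * y₀, h⟩
    obtain ⟨a, ha⟩ := this
    exact ⟨⟨a, (ha a).2 rfl⟩, a, (ha a).2 rfl, fun M hM => (ha M).1 hM⟩
  · exact (isMode_mcKayTypeI_iff_of_nonpos hm hm0 hb hc M).1 hM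
  · have hm2 : -1 / 2 < m := by linarith
    have hd : 0 < c ^ 2 - 1 := by nlinarith
    have hκ : 0 < b * c / (c ^ 2 - 1) := by positivity
    obtain ⟨h0, hlow, hup, halt⟩ := mode_bounds hm hb hc hM
    have hs := mul_lt_mul_of_pos_left (sqrt_mode_bound_lt hm hc) hκ
    refine ⟨⟨h0, ?_⟩, ⟨?_, hup, ?_⟩, ⟨integrable_id_mcKayTypeI hm2 hb hc, ?_, ?_, ?_⟩, halt⟩
    · obtain ⟨y₀, -, -, -, hiff, hmax⟩ := exists_mode_mcKayTypeI hm hb hc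
      rw [(hiff M).1 hM]
      exact hmax
    · exact lt_of_eq_of_lt (by ring) hlow
    · rw [show 2 * m * b * c / (c ^ 2 - 1) = b * c / (c ^ 2 - 1) * (2 * m) by ring]
      linarith
    · linarith
    · rw [integral_id_mcKayTypeI hm2 hb hc]
      linarith
    · rw [integral_id_mcKayTypeI hm2 hb hc,
        show 2 * b * c / (c ^ 2 - 1) = b * c / (c ^ 2 - 1) * 2 by ring]
      linarith
  · intro m b c M hm hb hc hM
    exact (show (2 * m - 1) * b * c / (c ^ 2 - 1) = (2 * m - 1) * (b * c / (c ^ 2 - 1)) by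
      ring).trans_le (mode_bounds hm hb hc hM).2.1.le
  · intro α hα
    -- At `m = b = 1`, dividing by `c/(c²-1)` puts `2 - α` below the square-root bracket for every
    -- `c > 1`.
    have : 2 - α ≤ 1 := by
      refine le_one_of_forall_le_mode_bound fun c hc => ?_
      obtain ⟨M, hM⟩ := exists_isMode_mcKayTypeI one_pos one_pos hc
      have hd : 0 < c ^ 2 - 1 := by nlinarith
      have h1 := (hα 1 1 c M one_pos one_pos hc hM).trans
        (mode_bounds one_pos one_pos hc hM).2.2.1.le
      rw [show (2 * 1 - α) * 1 * c / (c ^ 2 - 1) = 1 * c / (c ^ 2 - 1) * (2 - α) by ring] at h1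
      exact le_of_mul_le_mul_left h1 (by positivity)
    linarith
  · intro m b c M hm hb hc hM
    have hd : 0 < c ^ 2 - 1 := by nlinarith
    have hκ : 0 < b * c / (c ^ 2 - 1) := by positivity
    have hs := mul_lt_mul_of_pos_left (sqrt_mode_bound_lt hm hc) hκ
    have hup := (mode_bounds hm hb hc hM).2.2.1
    rw [show (2 * m - 0) * b * c / (c ^ 2 - 1) = b * c / (c ^ 2 - 1) * (2 * m) by ring]
    linarith
  · intro α hα
    refine le_of_forall_pos_lt_add fun ε hε => ?_
    -- With `m = ε/2`, positivity of the mode alone forces `α < 2m = ε`; the values of `b` and `c`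
    -- play no role.
    obtain ⟨M, hM⟩ := exists_isMode_mcKayTypeI (half_pos hε) one_pos one_lt_two
    have h1 := (mode_bounds (half_pos hε) one_pos one_lt_two hM).1.trans_le
      (hα (ε / 2) 1 2 M (half_pos hε) one_pos one_lt_two hM)
    norm_num at h1
    linarith
  · intro m b c M hm hb hc hM
    have hd : 0 < c ^ 2 - 1 := by nlinarith
    have hκ : 0 < b * c / (c ^ 2 - 1) := by positivity
    have hs := mul_lt_mul_of_pos_left (sqrt_mode_bound_lt hm hc) hκ
    have hup := (mode_bounds hm hb hc hM).2.2.1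
    rw [integral_id_mcKayTypeI (by linarith) hb hc,
      show 1 * b * c / (c ^ 2 - 1) = b * c / (c ^ 2 - 1) by ring]
    linarith
  · intro β hβ
    refine le_of_forall_pos_lt_add fun ε hε => ?_
    -- With `m = ε/2` the mean is `1 + ε` in units of `bc/(c²-1)`, and subtracting a positive mode
    -- only lowers it.
    obtain ⟨M, hM⟩ := exists_isMode_mcKayTypeI (half_pos hε) one_pos one_lt_two
    have h0 := (mode_bounds (half_pos hε) one_pos one_lt_two hM).1
    have h1 := hβ (ε / 2) 1 2 M (half_pos hε) one_pos one_lt_two hM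
    rw [integral_id_mcKayTypeI (by linarith) one_pos one_lt_two] at h1
    norm_num at h1
    linarith
  · intro m b c M hm hb hc hM
    have hlow := (mode_bounds hm hb hc hM).2.1
    rw [integral_id_mcKayTypeI (by linarith) hb hc,
      show 2 * b * c / (c ^ 2 - 1) = b * c / (c ^ 2 - 1) * 2 by ring]
    linarith
  · intro β hβ
    -- At `m = 1` the mean is 3 units, so `3 - β` lies below the mode in those units, hence below
    -- the square-root bracket.
    have : 3 - β ≤ 1 := by
      refine le_one_of_forall_le_mode_bound fun c hc => ?_
      obtain ⟨M, hM⟩ := exists_isMode_mcKayTypeI one_pos one_pos hc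
      have hd : 0 < c ^ 2 - 1 := by nlinarith
      have hup := (mode_bounds one_pos one_pos hc hM).2.2.1
      have h1 := hβ 1 1 c M one_pos one_pos hc hM
      rw [integral_id_mcKayTypeI (by norm_num) one_pos hc,
        show β * 1 * c / (c ^ 2 - 1) = 1 * c / (c ^ 2 - 1) * β by ring] at h1
      refine le_of_mul_le_mul_left (a := 1 * c / (c ^ 2 - 1)) ?_ (by positivity)
      linarith
    linarith
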